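/- Let $\mathbb{D}_1^\infty=\{\zeta=(\zeta_j)_{j\ge1}\in\ell^1: |\zeta_j|<1 \text{ for all } j\}$, a domain in the complex Banach space $\ell^1$. A function $F:\mathbb{D}_1^\infty\to\mathbb{C}$ is called analytic if it is locally bounded and, for all $\zeta\in\mathbb{D}_1^\infty$ and $\eta\in\ell^1$, the function $z\mapsto F(\zeta+z\eta)$ is analytic on $\{z\in\mathbb{C}:\zeta+z\eta\in\mathbb{D}_1^\infty\}$. For $1\le p<\infty$ let $\mathbf{H}^p_\infty$ be the space of all analytic functions $F$ on $\mathbb{D}_1^\infty$ with $$\|F\|_p^p=\sup_{0<r<1}\int_{\mathbb{T}^\infty}|F(rw_1,r^2w_2,\ldots,r^nw_n,\ldots)|^p\,\mathrm{d}m_\infty(w)<\infty,$$ where $m_\infty=\frac{\mathrm{d}\theta_1}{2\pi}\times\frac{\mathrm{d}\theta_2}{2\pi}\times\cdots$ is the Haar measure of the infinite torus $\mathbb{T}^\infty$. For a positive integer $n=p_1^{\alpha_1}\cdots p_k^{\alpha_k}$, where $p_j$ is the $j$-th prime, write $\zeta^{\alpha(n)}=\zeta_1^{\alpha_1}\cdots\zeta_k^{\alpha_k}$.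 Each $F\in\mathbf{H}^p_\infty$ has a unique absolutely convergent monomial expansion $F(\zeta)=\sum_{n=1}^\infty a_n\zeta^{\alpha(n)}$, $\zeta\in\mathbb{D}_1^\infty$, and by identifying $F$ with $\{a_n\}_{n=1}^\infty$ we regard $\mathbf{H}^p_\infty$ as a linear space of complex sequences. A linear space $\mathcal{X}$ of complex sequences is called solid if $\{y_n\}\in\mathcal{X}$ whenever $\{x_n\}\in\mathcal{X}$ and $|y_n|\le|x_n|$ for all $n$; the solid core $s(\mathcal{X})$ of a linear space $\mathcal{X}$ of complex sequences is the largest solid space contained in $\mathcal{X}$. Proposition. If $1\le p\le2$, then $s(\mathbf{H}^p_\infty)=\ell^2$. -/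

import Mathlib

open MeasureTheory Filter Topology
open scoped ENNReal

noncomputable section

namespace HardyInfinite

/-! ### The domain `𝔻₁^∞ = 𝔻^∞ ∩ ℓ¹` and analytic functions on it

Variables are indexed by `ℕ` starting from `0`, so that the variable written `ζ_{j+1}` on paper
is `ζ j` here. -/

/-- The complex Banach space `ℓ¹`. -/
abbrev EllOne : Type := lp (fun _ : ℕ => ℂ) 1

/-- The domain `𝔻₁^∞ = 𝔻^∞ ∩ ℓ¹`, as a subset of `ℓ¹`. -/
def polydisk : Set EllOne := {ζ | ∀ j, ‖ζ j‖ < 1}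

/-- `F` is analytic on `𝔻₁^∞`: it is locally bounded there (in the norm of `ℓ¹`), and for all
`ζ ∈ 𝔻₁^∞` and `η ∈ ℓ¹` the function `z ↦ F (ζ + z η)` is analytic on the set of those `z ∈ ℂ` for
which `ζ + z η ∈ 𝔻₁^∞`. Only the values of `F` on `𝔻₁^∞` matter. -/
structure IsAnalytic (F : EllOne → ℂ) : Prop where
  locallyBounded : ∀ ζ ∈ polydisk, ∃ C : ℝ, ∀ᶠ ξ in 𝓝[polydisk] ζ, ‖F ξ‖ ≤ C
  analyticOnLines : ∀ ζ ∈ polydisk, ∀ η : EllOne,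
    AnalyticOnNhd ℂ (fun z : ℂ => F (ζ + z • η)) {z : ℂ | ζ + z • η ∈ polydisk}

/-! ### Monomials `ζ^{α(n)}` -/

/-- The exponent sequence `α(n)`: its `j`-th entry is the exponent of the `j`-th prime in `n`. -/
def expo (n : ℕ+) (j : ℕ) : ℕ := (n : ℕ).factorization (Nat.nth Nat.Prime j)

/-- The exponent sequence of `n` vanishes from index `n` on. -/
lemma expo_eq_zero (n : ℕ+) {j : ℕ} (hj : (n : ℕ) ≤ j) : expo n j = 0 := by
  apply Nat.factorization_eq_zero_of_lt
  have := Nat.add_two_le_nth_prime j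
  omega

/-- The monomial `ζ^{α(n)} = ∏_j ζ_j^{α(n)_j}`; all factors with index `j ≥ n` are `1`. -/
def monomial (n : ℕ+) (ζ : ℕ → ℂ) : ℂ := ∏ j ∈ Finset.range n, ζ j ^ expo n j

/-! ### The Hardy space -/

/-- The infinite torus `𝕋^∞`; the point `(θ_j)_j` stands for `(w_j)_j = (e^{i θ_j})_j`. -/
abbrev Torus : Type := ℕ → AddCircle (2 * Real.pi)

instance instFactTwoPiPos : Fact (0 < 2 * Real.pi) := ⟨Real.two_pi_pos⟩

/-- The measure `m_∞ = dθ_1/2π × dθ_2/2π × ⋯`. -/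
def torusMeasure : Measure Torus := Measure.infinitePi fun _ => AddCircle.haarAddCircle

lemma memLp_dilate {r : ℝ} (hr : r ∈ Set.Ioo (0 : ℝ) 1) (θ : Torus) :
    Memℓp (fun j : ℕ => (r : ℂ) ^ (j + 1) * (AddCircle.toCircle (θ j) : ℂ)) 1 := by
  apply memℓp_gen
  have h : Summable fun j : ℕ => r ^ (j + 1) := by
    simpa [pow_succ] using (summable_geometric_of_lt_one hr.1.le hr.2).mul_right r
  simpa [abs_of_pos hr.1, Circle.norm_coe] using h

/-- The point `(r w_1, r² w_2, …, rⁿ w_n, …)` of `ℓ¹`, where `w ∈ 𝕋^∞` and `0 < r < 1`. -/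
def dilate (r : Set.Ioo (0 : ℝ) 1) (θ : Torus) : EllOne :=
  ⟨fun j : ℕ => ((r : ℝ) : ℂ) ^ (j + 1) * (AddCircle.toCircle (θ j) : ℂ), memLp_dilate r.2 θ⟩

/-- `‖F‖_p^p = sup_{0<r<1} ∫_{𝕋^∞} |F(r w_1, r² w_2, …)|^p dm_∞(w)`, as an element of `[0, ∞]`. -/
def hardyNormPow (p : ℝ) (F : EllOne → ℂ) : ℝ≥0∞ :=
  ⨆ r : Set.Ioo (0 : ℝ) 1, ∫⁻ θ, ‖F (dilate r θ)‖ₑ ^ p ∂torusMeasure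

/-- `F` belongs to the Hardy space `H^p_∞` over `𝔻₁^∞`. -/
def MemHardy (p : ℝ) (F : EllOne → ℂ) : Prop := IsAnalytic F ∧ hardyNormPow p F < ∞

/-- `F` has on `𝔻₁^∞` the (absolutely convergent) monomial expansion `F(ζ) = ∑ a_n ζ^{α(n)}`. -/
def HasMonomialExpansion (F : EllOne → ℂ) (a : ℕ+ → ℂ) : Prop :=
  ∀ ζ ∈ polydisk, HasSum (fun n : ℕ+ => a n * monomial n (fun j => ζ j)) (F ζ)

/-! #### Facts showing that `H^p_∞` is a linear space -/

lemma isOpen_polydisk : IsOpen polydisk := by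
  rw [isOpen_iff_mem_nhds]
  intro ζ hζ
  have hcont : ∀ j : ℕ, Continuous fun ξ : EllOne => ‖ξ j‖ := fun j =>
    ((continuous_apply j).comp
      (lp.uniformContinuous_coe (E := fun _ : ℕ => ℂ) (p := 1)).continuous).norm
  have hs : Summable fun j => ‖ζ j‖ := by
    simpa using (lp.memℓp ζ).summable (by simp)
  have hfin : {j | ¬ ‖ζ j‖ < 1 / 2}.Finite := by
    have := hs.tendsto_cofinite_zero.eventually_lt_const (show (0 : ℝ) < 1 / 2 by norm_num)
    simpa [eventually_cofinite] using this
  have h1 : ∀ᶠ ξ in 𝓝 ζ, ∀ j ∈ {j | ¬ ‖ζ j‖ < 1 / 2}, ‖ξ j‖ < 1 := by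
    rw [eventually_all_finite hfin]
    intro j _
    exact (hcont j).continuousAt.eventually_lt_const (hζ j)
  filter_upwards [h1, Metric.ball_mem_nhds ζ (show (0 : ℝ) < 1 / 2 by norm_num)] with ξ h1 h2 j
  by_cases hj : ‖ζ j‖ < 1 / 2
  · have h3 := lp.norm_apply_le_norm (p := 1) (by simp) (ξ - ζ) j
    rw [Metric.mem_ball, dist_eq_norm] at h2
    have h4 : ‖ξ j‖ ≤ ‖(ξ - ζ) j‖ + ‖ζ j‖ := by
      simpa using norm_add_le ((ξ - ζ) j) (ζ j)
    linarith
  · exact h1 j hj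

lemma dilate_mem_polydisk (r : Set.Ioo (0 : ℝ) 1) (θ : Torus) : dilate r θ ∈ polydisk := by
  intro j
  have h : ‖dilate r θ j‖ = (r : ℝ) ^ (j + 1) := by
    simp [dilate, abs_of_pos r.2.1, Circle.norm_coe]
  rw [h]
  exact pow_lt_one₀ r.2.1.le r.2.2 (by omega)

lemma continuous_dilate (r : Set.Ioo (0 : ℝ) 1) : Continuous (dilate r) := by
  have h : dilate r = fun θ => ∑' j : ℕ,
      lp.single (E := fun _ : ℕ => ℂ) 1 j (dilate r θ j) := by
    funext θ
    exact ((lp.hasSum_single (by simp) (dilate r θ)).tsum_eq).symm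
  rw [h]
  refine continuous_tsum (u := fun j : ℕ => (r : ℝ) ^ (j + 1)) ?_ ?_ ?_
  · intro j
    refine (lp.isometry_single (E := fun _ : ℕ => ℂ) (p := 1) j).continuous.comp ?_
    change Continuous fun θ : Torus =>
      ((r : ℝ) : ℂ) ^ (j + 1) * (AddCircle.toCircle (θ j) : ℂ)
    exact continuous_const.mul (continuous_subtype_val.comp
      (AddCircle.continuous_toCircle.comp (continuous_apply j)))
  · simpa [pow_succ] using (summable_geometric_of_lt_one r.2.1.le r.2.2).mul_right (r : ℝ)
  · intro j θ
    rw [lp.norm_single (by simp)]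
    simp [dilate, abs_of_pos r.2.1, Circle.norm_coe]

lemma IsAnalytic.continuousOn {F : EllOne → ℂ} (hF : IsAnalytic F) :
    ContinuousOn F polydisk := by
  intro ζ hζ
  apply ContinuousAt.continuousWithinAt
  obtain ⟨C, hC⟩ := hF.locallyBounded ζ hζ
  rw [isOpen_polydisk.nhdsWithin_eq hζ] at hC
  obtain ⟨ρ, hρ, hball⟩ := Metric.eventually_nhds_iff.1
    (hC.and (isOpen_polydisk.mem_nhds hζ))
  have hC0 : ‖F ζ‖ ≤ C := (hball (by simpa using hρ)).1
  have key : ∀ ξ, dist ξ ζ < ρ → dist (F ξ) (F ζ) ≤ 2 * C / ρ * dist ξ ζ := by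
    intro ξ hξ
    rcases eq_or_ne ξ ζ with rfl | hne
    · simp
    have hd : 0 < ‖ξ - ζ‖ := norm_pos_iff.2 (sub_ne_zero.2 hne)
    rw [dist_eq_norm] at hξ
    have hin : ∀ z ∈ Metric.ball (0 : ℂ) (ρ / ‖ξ - ζ‖),
        ‖F (ζ + z • (ξ - ζ))‖ ≤ C ∧ ζ + z • (ξ - ζ) ∈ polydisk := by
      intro z hz
      apply hball
      rw [dist_eq_norm, add_sub_cancel_left, norm_smul]
      rw [mem_ball_zero_iff, lt_div_iff₀ hd] at hz
      exact hz
    have h := Complex.dist_le_div_mul_dist_of_mapsTo_ball (R₂ := 2 * C) (z := 1)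
      (f := fun z : ℂ => F (ζ + z • (ξ - ζ))) (c := 0) (R₁ := ρ / ‖ξ - ζ‖)
      (fun z hz => ((hF.analyticOnLines ζ hζ (ξ - ζ)) z
        (hin z hz).2).differentiableAt.differentiableWithinAt)
      (fun z hz => by
        rw [Metric.mem_closedBall, dist_eq_norm]
        refine (norm_sub_le _ _).trans ?_
        have := (hin z hz).1
        simp only [zero_smul, add_zero]
        linarith)
      (by rw [mem_ball_zero_iff, lt_div_iff₀ hd]; simpa using hξ)
    simp only [one_smul, zero_smul, add_zero, add_sub_cancel, dist_zero_right, norm_one,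
      mul_one] at h
    rw [dist_eq_norm ξ ζ]
    calc _ ≤ _ := h
      _ = _ := by field_simp
  rw [ContinuousAt, tendsto_iff_dist_tendsto_zero]
  refine squeeze_zero' (Eventually.of_forall fun _ => dist_nonneg)
    (Metric.eventually_nhds_iff.2 ⟨ρ, hρ, fun ξ hξ => key ξ hξ⟩) ?_
  have : Continuous fun ξ : EllOne => 2 * C / ρ * dist ξ ζ := by fun_prop
  simpa using this.tendsto ζ

lemma IsAnalytic.continuous_dilate {F : EllOne → ℂ} (hF : IsAnalytic F)
    (r : Set.Ioo (0 : ℝ) 1) : Continuous fun θ => F (dilate r θ) :=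
  hF.continuousOn.comp_continuous (HardyInfinite.continuous_dilate r) (dilate_mem_polydisk r)

lemma memHardy_zero {p : ℝ} (hp : 1 ≤ p) : MemHardy p fun _ => 0 := by
  refine ⟨⟨fun _ _ => ⟨0, by simp⟩, fun _ _ _ => analyticOnNhd_const⟩, ?_⟩
  simp [hardyNormPow, ENNReal.zero_rpow_of_pos (show 0 < p by linarith)]

lemma MemHardy.add {p : ℝ} (hp : 1 ≤ p) {F G : EllOne → ℂ} (hF : MemHardy p F)
    (hG : MemHardy p G) : MemHardy p fun ζ => F ζ + G ζ := by
  refine ⟨⟨fun ζ hζ => ?_, fun ζ hζ η => (hF.1.analyticOnLines ζ hζ η).add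
    (hG.1.analyticOnLines ζ hζ η)⟩, ?_⟩
  · obtain ⟨C, hC⟩ := hF.1.locallyBounded ζ hζ
    obtain ⟨D, hD⟩ := hG.1.locallyBounded ζ hζ
    refine ⟨C + D, ?_⟩
    filter_upwards [hC, hD] with ξ h1 h2
    exact (norm_add_le _ _).trans (add_le_add h1 h2)
  · have hle : hardyNormPow p (fun ζ => F ζ + G ζ) ≤
        2 ^ (p - 1) * (hardyNormPow p F + hardyNormPow p G) := by
      refine iSup_le fun r => ?_
      calc ∫⁻ θ, ‖F (dilate r θ) + G (dilate r θ)‖ₑ ^ p ∂torusMeasure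
          ≤ ∫⁻ θ, 2 ^ (p - 1) * (‖F (dilate r θ)‖ₑ ^ p + ‖G (dilate r θ)‖ₑ ^ p)
              ∂torusMeasure := by
            refine lintegral_mono fun θ => ?_
            exact (ENNReal.rpow_le_rpow (enorm_add_le _ _) (by linarith)).trans
              (ENNReal.rpow_add_le_mul_rpow_add_rpow _ _ hp)
        _ = 2 ^ (p - 1) * (∫⁻ θ, ‖F (dilate r θ)‖ₑ ^ p ∂torusMeasure +
              ∫⁻ θ, ‖G (dilate r θ)‖ₑ ^ p ∂torusMeasure) := by
            rw [lintegral_const_mul' _ _ (by simp), lintegral_add_left]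
            exact ((hF.1.continuous_dilate r).measurable.enorm.pow_const p)
        _ ≤ _ := by
            gcongr
            · exact le_iSup (fun r : Set.Ioo (0 : ℝ) 1 =>
                ∫⁻ θ, ‖F (dilate r θ)‖ₑ ^ p ∂torusMeasure) r
            · exact le_iSup (fun r : Set.Ioo (0 : ℝ) 1 =>
                ∫⁻ θ, ‖G (dilate r θ)‖ₑ ^ p ∂torusMeasure) r
    exact hle.trans_lt (ENNReal.mul_lt_top (by simp [lt_top_iff_ne_top])
      (ENNReal.add_lt_top.2 ⟨hF.2, hG.2⟩))

lemma MemHardy.const_mul {p : ℝ} (hp : 1 ≤ p) (c : ℂ) {F : EllOne → ℂ} (hF : MemHardy p F) :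
    MemHardy p fun ζ => c * F ζ := by
  refine ⟨⟨fun ζ hζ => ?_, fun ζ hζ η => analyticOnNhd_const.mul
    (hF.1.analyticOnLines ζ hζ η)⟩, ?_⟩
  · obtain ⟨C, hC⟩ := hF.1.locallyBounded ζ hζ
    refine ⟨‖c‖ * C, ?_⟩
    filter_upwards [hC] with ξ h1
    rw [norm_mul]
    gcongr
  · have hp0 : 0 ≤ p := by linarith
    have hle : hardyNormPow p (fun ζ => c * F ζ) ≤ ‖c‖ₑ ^ p * hardyNormPow p F := by
      refine iSup_le fun r => ?_
      simp only [enorm_mul, ENNReal.mul_rpow_of_nonneg _ _ hp0]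
      rw [lintegral_const_mul' _ _ (ENNReal.rpow_ne_top_of_nonneg hp0 enorm_ne_top)]
      gcongr
      exact le_iSup (fun r : Set.Ioo (0 : ℝ) 1 =>
        ∫⁻ θ, ‖F (dilate r θ)‖ₑ ^ p ∂torusMeasure) r
    exact hle.trans_lt (ENNReal.mul_lt_top
      (ENNReal.rpow_lt_top_of_nonneg hp0 enorm_ne_top) hF.2)

/-- The Hardy space `H^p_∞`, `1 ≤ p < ∞`, regarded as a linear space of complex sequences: the
sequences of coefficients in the monomial expansions of its elements. -/
def hardySpace (p : ℝ) (hp : 1 ≤ p) : Submodule ℂ (ℕ+ → ℂ) where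
  carrier := {a | ∃ F : EllOne → ℂ, MemHardy p F ∧ HasMonomialExpansion F a}
  zero_mem' := ⟨fun _ => 0, memHardy_zero hp, fun ζ _ => by simp⟩
  add_mem' := by
    rintro a b ⟨F, hF, hFa⟩ ⟨G, hG, hGb⟩
    refine ⟨_, hF.add hp hG, fun ζ hζ => ?_⟩
    simpa [add_mul] using (hFa ζ hζ).add (hGb ζ hζ)
  smul_mem' := by
    rintro c a ⟨F, hF, hFa⟩
    refine ⟨_, hF.const_mul hp c, fun ζ hζ => ?_⟩
    simpa [mul_assoc] using (hFa ζ hζ).mul_left c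

/-! ### Solid spaces and the solid core -/

/-- A linear space `X` of complex sequences is solid if `y ∈ X` whenever `x ∈ X` and
`|y_n| ≤ |x_n|` for all `n`. -/
def IsSolid (X : Submodule ℂ (ℕ+ → ℂ)) : Prop :=
  ∀ x ∈ X, ∀ y : ℕ+ → ℂ, (∀ n, ‖y n‖ ≤ ‖x n‖) → y ∈ X

/-- The solid core of a linear space `X` of complex sequences: the largest solid space contained
in `X` (see `isGreatest_solidCore`), constructed as the supremum of all of them. -/
def solidCore (X : Submodule ℂ (ℕ+ → ℂ)) : Submodule ℂ (ℕ+ → ℂ) :=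
  sSup {Y | IsSolid Y ∧ Y ≤ X}

lemma isGreatest_solidCore (X : Submodule ℂ (ℕ+ → ℂ)) :
    IsGreatest {Y | IsSolid Y ∧ Y ≤ X} (solidCore X) := by
  refine ⟨⟨?_, sSup_le fun Y hY => hY.2⟩, fun Y hY => le_sSup hY⟩
  intro x hx
  have hx' : x ∈ ⨆ Y : {Y | IsSolid Y ∧ Y ≤ X}, (Y : Submodule ℂ (ℕ+ → ℂ)) := by
    rwa [← sSup_eq_iSup']
  clear hx
  refine Submodule.iSup_induction _
    (motive := fun x => ∀ y : ℕ+ → ℂ, (∀ n, ‖y n‖ ≤ ‖x n‖) → y ∈ solidCore X) hx' ?_ ?_ ?_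
  · intro Y x hxY y hy
    exact (le_sSup Y.2 : (Y : Submodule ℂ (ℕ+ → ℂ)) ≤ _) (Y.2.1 x hxY y hy)
  · intro y hy
    have : y = 0 := by
      funext n
      simpa using hy n
    rw [this]
    exact Submodule.zero_mem _
  · intro u v hu hv y hy
    have hθ : ∀ n, ‖y n / (u n + v n)‖ ≤ 1 := fun n => by
      rw [norm_div]
      exact div_le_one_of_le₀ (hy n) (norm_nonneg _)
    have hsum : y = (fun n => y n / (u n + v n) * u n) + fun n => y n / (u n + v n) * v n := by
      funext n
      rw [Pi.add_apply, ← mul_add]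
      by_cases h : u n + v n = 0
      · have h0 := hy n
        rw [Pi.add_apply, h, norm_zero] at h0
        rw [h, mul_zero, norm_le_zero_iff.1 h0]
      · rw [div_mul_cancel₀ _ h]
    rw [hsum]
    refine Submodule.add_mem _ (hu _ fun n => ?_) (hv _ fun n => ?_)
    all_goals
      rw [norm_mul]
      exact mul_le_of_le_one_left (norm_nonneg _) (hθ n)

/-- The solid core of `X` consists of the sequences `λ` such that `(λ_n x_n)_n ∈ X` for every
bounded sequence `x`. -/
lemma mem_solidCore_iff (X : Submodule ℂ (ℕ+ → ℂ)) (l : ℕ+ → ℂ) :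
    l ∈ solidCore X ↔
      ∀ x : ℕ+ → ℂ, Memℓp x ∞ → (fun n => l n * x n) ∈ X := by
  constructor
  · intro hl x hx
    obtain ⟨C, hC⟩ := memℓp_infty_iff.1 hx
    have h : ∀ n, ‖x n‖ ≤ C := fun n => hC ⟨n, rfl⟩
    refine (isGreatest_solidCore X).1.2 ((isGreatest_solidCore X).1.1 ((C : ℂ) • l)
      (Submodule.smul_mem _ _ hl) _ fun n => ?_)
    have hC0 : 0 ≤ C := (norm_nonneg _).trans (h n)
    rw [norm_mul, Pi.smul_apply, norm_smul, mul_comm, Complex.norm_of_nonneg hC0]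
    gcongr
    exact h n
  · intro hl
    let Y : Submodule ℂ (ℕ+ → ℂ) :=
      { carrier := {l | ∀ x : ℕ+ → ℂ, Memℓp x ∞ → (fun n => l n * x n) ∈ X}
        zero_mem' := fun x _ => by
          simpa only [Pi.zero_apply, zero_mul] using! X.zero_mem
        add_mem' := fun {a b} ha hb x hx => by
          simpa only [Pi.add_apply, add_mul] using! X.add_mem (ha x hx) (hb x hx)
        smul_mem' := fun c a ha x hx => by
          simpa only [Pi.smul_apply, smul_eq_mul, mul_assoc] using! X.smul_mem c (ha x hx) }
    refine (isGreatest_solidCore X).2 (show Y ∈ _ from ⟨?_, ?_⟩) hl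
    · intro a ha y hy x hx
      obtain ⟨C, hC⟩ := memℓp_infty_iff.1 hx
      have h : ∀ n, ‖x n‖ ≤ C := fun n => hC ⟨n, rfl⟩
      have hm : Memℓp (fun n => y n / a n * x n) ∞ := by
        refine memℓp_infty_iff.2 ⟨C, ?_⟩
        rintro _ ⟨n, rfl⟩
        dsimp only
        rw [norm_mul, norm_div]
        exact (mul_le_of_le_one_left (norm_nonneg _)
          (div_le_one_of_le₀ (hy n) (norm_nonneg _))).trans (h n)
      convert ha _ hm using 2 with n
      by_cases h0 : a n = 0
      · have h1 := hy n
        rw [h0, norm_zero] at h1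
        rw [h0, norm_le_zero_iff.1 h1]
        simp
      · field_simp
    · intro a ha
      simpa using ha (fun _ => 1) (memℓp_infty_iff.2 ⟨1, by rintro _ ⟨n, rfl⟩; simp⟩)

end HardyInfinite

end

namespace HardyInfinite

/-! Square summable sequences lie in the core because `ℓ²` is solid and contained in `H^p`. The
Euler product `∑ |ζ^{α(n)}|² = ∏ (1 - |ζ_j|²)⁻¹` is locally bounded on the polydisk
(`exists_sum_sq_norm_monomial_le`), so an `ℓ²` coefficient sequence gives a locally uniformly
convergent, hence analytic, monomial series. The monomials are orthogonal on the torus, so its `L²`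
means are at most `∑ |a_n|²`, and `p ≤ 2` on a probability space does the rest
(`memHardy_monomialSeries`).

Conversely, let `a` be in the core. Every 0/1 mask of `a` then has bounded `L¹` means, with a bound
depending on the mask. Baire's theorem on the space of masks makes the bound uniform over a cylinder
that fixes finitely many coordinates `I` (`exists_cylinder_integral_norm_le`). For finite `T`
disjoint from `I`, any signed sum of the terms over `T` is a difference of two masked series from
the cylinder, so its `L¹` mean is bounded as well. Averaging over signs and applying Khinchine's
inequality pointwise on the torus, where each monomial has constant modulus, bounds `∑_T |a_n|²`
after `r → 1`. -/

/-! ### Monomials and the Euler product -/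

lemma nth_prime_injective : Function.Injective (Nat.nth Nat.Prime) :=
  Nat.nth_injective Nat.infinite_setOfPred_prime

/-- The product `∏_j x_j ^ α(m)_j`, as a completely multiplicative function of `m`. -/
noncomputable def primeEval (x : ℕ → ℝ) : ℕ →*₀ ℝ where
  toFun m := if m = 0 then 0 else
    m.factorization.prod fun q e => x (Nat.count Nat.Prime q) ^ e
  map_zero' := by simp
  map_one' := by simp
  map_mul' a b := by
    by_cases ha : a = 0
    · simp [ha]
    by_cases hb : b = 0
    · simp [hb]
    simp only [ha, hb, mul_eq_zero, or_self, if_false]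
    rw [Nat.factorization_mul ha hb, Finsupp.prod_add_index'] <;> simp [pow_add]

lemma primeEval_prime (x : ℕ → ℝ) {q : ℕ} (hq : q.Prime) :
    primeEval x q = x (Nat.count Nat.Prime q) := by
  change (if q = 0 then 0 else _) = _
  rw [if_neg hq.ne_zero, hq.factorization, Finsupp.prod_single_index] <;> simp

lemma primeEval_eq_prod (x : ℕ → ℝ) (n : ℕ+) :
    primeEval x n = ∏ j ∈ Finset.range n, x j ^ expo n j := by
  change (if (n : ℕ) = 0 then 0 else _) = _
  rw [if_neg n.ne_zero]
  have h : ∀ j, x j ^ expo n j = x (Nat.count Nat.Prime (Nat.nth Nat.Prime j)) ^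
      (n : ℕ).factorization (Nat.nth Nat.Prime j) := fun j => by
    rw [Nat.count_nth_of_infinite Nat.infinite_setOfPred_prime, expo]
  simp_rw [h]
  rw [← Finset.prod_image (f := fun q => x (Nat.count Nat.Prime q) ^ (n : ℕ).factorization q)
    nth_prime_injective.injOn]
  refine Finsupp.prod_of_support_subset _ (fun q hq => ?_) _ (by simp)
  have hp : q.Prime := Nat.prime_of_mem_primeFactors hq
  have hle : q ≤ n := Nat.le_of_mem_primeFactors hq
  refine Finset.mem_image.2 ⟨Nat.count Nat.Prime q, ?_, Nat.nth_count hp⟩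
  -- The prime of index `j` is at least `j + 2`, so prime factors of `n` have index below `n`.
  have := Nat.add_two_le_nth_prime (Nat.count Nat.Prime q)
  rw [Nat.nth_count hp] at this
  exact Finset.mem_range.2 (by omega)

lemma expo_injective {n k : ℕ+} (h : ∀ j, expo n j = expo k j) : n = k := by
  apply PNat.coe_injective
  refine Nat.eq_of_factorization_eq n.ne_zero k.ne_zero fun q => ?_
  by_cases hq : q.Prime
  · simpa [expo, Nat.nth_count hq] using h (Nat.count Nat.Prime q)
  · simp [Nat.factorization_eq_zero_of_not_prime _ hq]

/-- Partial sums of the Euler product `∑_n x^{α(n)} = ∏_j (1 - x_j)⁻¹`. -/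
lemma sum_prod_pow_expo_le {x : ℕ → ℝ} {ρ S : ℝ} (hρ : ρ < 1) (hx0 : ∀ j, 0 ≤ x j)
    (hxρ : ∀ j, x j ≤ ρ) (hS : ∀ T : Finset ℕ, ∑ j ∈ T, x j ≤ S) (T : Finset ℕ+) :
    ∑ n ∈ T, ∏ j ∈ Finset.range n, x j ^ expo n j ≤ Real.exp (S / (1 - ρ)) := by
  -- All of `T` consists of `N`-smooth numbers, so a finite Euler product dominates the sum; the
  -- final bound must not depend on `N`.
  obtain ⟨N, hN⟩ : ∃ N : ℕ, ∀ n ∈ T, (n : ℕ) < N := by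
    refine ⟨T.sup (fun n => (n : ℕ)) + 1, fun n hn => ?_⟩
    exact Nat.lt_succ_of_le (Finset.le_sup (f := fun n : ℕ+ => (n : ℕ)) hn)
  have hEuler := (EulerProduct.summable_and_hasSum_smoothNumbers_prod_primesBelow_geometric
    (f := (primeEval x : ℕ →* ℝ)) (fun {q} hq => by
      simp only [MonoidHom.coe_coe, primeEval_prime x hq]
      rw [Real.norm_of_nonneg (hx0 _)]
      exact (hxρ _).trans_lt hρ) N).2
  simp only [MonoidHom.coe_coe] at hEuler
  have hnn : ∀ n : ℕ, 0 ≤ primeEval x n := fun n => by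
    rcases Nat.eq_zero_or_pos n with rfl | hn
    · simp
    · obtain ⟨k, rfl⟩ : ∃ k : ℕ+, (k : ℕ) = n := ⟨⟨n, hn⟩, rfl⟩
      rw [primeEval_eq_prod]
      exact Finset.prod_nonneg fun j _ => pow_nonneg (hx0 j) _
  let e : T → N.smoothNumbers := fun n =>
    ⟨(n : ℕ+), Nat.mem_smoothNumbers_of_lt n.1.pos (hN n n.2)⟩
  have he : Function.Injective e := fun a b hab =>
    Subtype.ext (PNat.coe_injective (congrArg (fun m : N.smoothNumbers => (m : ℕ)) hab))
  calc ∑ n ∈ T, ∏ j ∈ Finset.range n, x j ^ expo n j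
      = ∑ n : T, primeEval x (e n) := by
        rw [← Finset.sum_coe_sort]
        exact Finset.sum_congr rfl fun n _ => (primeEval_eq_prod x n).symm
    _ = ∑ m ∈ Finset.univ.image e, primeEval x m := by
        rw [Finset.sum_image he.injOn]
    _ ≤ ∏ q ∈ N.primesBelow, (1 - primeEval x q)⁻¹ :=
        sum_le_hasSum _ (fun m _ => hnn m) hEuler
    -- Here `(1 - t)⁻¹ = 1 + t / (1 - t) ≤ exp (t / (1 - ρ))`, which turns the product into a sum
    -- controlled by `S`.
    _ ≤ ∏ q ∈ N.primesBelow, Real.exp (x (Nat.count Nat.Prime q) / (1 - ρ)) := by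
        refine Finset.prod_le_prod (fun q hq => ?_) fun q hq => ?_
        all_goals
          rw [primeEval_prime x (Nat.prime_of_mem_primesBelow hq)]
          set t := x (Nat.count Nat.Prime q)
          have h0 : 0 ≤ t := hx0 _
          have h1 : t ≤ ρ := hxρ _
          have h2 : 0 < 1 - ρ := by linarith
          have h3 : 0 < 1 - t := by linarith
        · positivity
        · calc (1 - t)⁻¹ = t / (1 - t) + 1 := by field_simp; ring
            _ ≤ t / (1 - ρ) + 1 := by gcongr
            _ ≤ _ := Real.add_one_le_exp _
    _ = Real.exp ((∑ q ∈ N.primesBelow, x (Nat.count Nat.Prime q)) / (1 - ρ)) := by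
        rw [← Real.exp_sum, Finset.sum_div]
    _ ≤ Real.exp (S / (1 - ρ)) := by
        have h2 : 0 < 1 - ρ := by linarith
        gcongr
        rw [← Finset.sum_image (f := x) (g := Nat.count Nat.Prime)]
        · exact hS _
        · intro a ha b hb hab
          exact Nat.count_injective (Nat.prime_of_mem_primesBelow ha)
            (Nat.prime_of_mem_primesBelow hb) hab

lemma norm_monomial (n : ℕ+) (ζ : ℕ → ℂ) :
    ‖monomial n ζ‖ = ∏ j ∈ Finset.range n, ‖ζ j‖ ^ expo n j := by
  simp [monomial, norm_prod]

/-- The Euler product bound with `x_j = |ζ_j|²`; since `|ζ_j|² ≤ |ζ_j|`, the `ℓ¹` norm controls the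
exponent. -/
lemma sum_sq_norm_monomial_le {ζ : EllOne} {ρ : ℝ} (hρ : ρ < 1) (hζ : ∀ j, ‖ζ j‖ ≤ ρ)
    (T : Finset ℕ+) :
    ∑ n ∈ T, ‖monomial n fun j => ζ j‖ ^ 2 ≤ Real.exp (‖ζ‖ / (1 - ρ)) := by
  have hle : ∀ j, ‖ζ j‖ ^ 2 ≤ ‖ζ j‖ := fun j => by
    have h1 := hζ j
    nlinarith [norm_nonneg (ζ j)]
  have h := sum_prod_pow_expo_le (x := fun j => ‖ζ j‖ ^ 2) (S := ‖ζ‖) hρ (fun j => by positivity)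
    (fun j => (hle j).trans (hζ j))
    (fun T => (Finset.sum_le_sum fun j _ => hle j).trans
      (by simpa using lp.sum_rpow_le_norm_rpow (p := 1) (by simp) ζ T)) T
  refine le_of_eq_of_le (Finset.sum_congr rfl fun n _ => ?_) h
  rw [norm_monomial, ← Finset.prod_pow]
  exact Finset.prod_congr rfl fun j _ => pow_right_comm _ _ _

/-- Coordinates of an `ℓ¹` point tend to zero, so only finitely many are at least `1/2` and their
supremum `σ` stays below `1`. The `ℓ¹` distance dominates each coordinate, so a ball of radius `(1 -
σ) / 2` keeps a margin. -/
lemma exists_norm_le_of_mem_polydisk {ζ : EllOne} (hζ : ζ ∈ polydisk) :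
    ∃ ρ < 1, ∀ᶠ ξ in 𝓝 ζ, ∀ j, ‖ξ j‖ ≤ ρ := by
  have hs : Summable fun j => ‖ζ j‖ := by
    simpa using (lp.memℓp ζ).summable (by simp)
  have hfin : {j | ¬ ‖ζ j‖ < 1 / 2}.Finite := by
    have := hs.tendsto_cofinite_zero.eventually_lt_const (show (0 : ℝ) < 1 / 2 by norm_num)
    simpa [eventually_cofinite] using this
  obtain ⟨σ, hσ1, hσ⟩ : ∃ σ < (1 : ℝ), ∀ j, ‖ζ j‖ ≤ σ := by
    obtain ⟨σ, hσ1, hσ⟩ : ∃ σ < (1 : ℝ), ∀ j ∈ {j | ¬ ‖ζ j‖ < 1 / 2}, ‖ζ j‖ ≤ σ := by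
      have : ∀ᶠ σ in 𝓝[<] (1 : ℝ), ∀ j ∈ {j | ¬ ‖ζ j‖ < 1 / 2}, ‖ζ j‖ ≤ σ := by
        rw [eventually_all_finite hfin]
        exact fun j _ => (eventually_ge_nhds (hζ j)).filter_mono nhdsWithin_le_nhds
      obtain ⟨σ, h1, h2⟩ := (this.and self_mem_nhdsWithin).exists
      exact ⟨σ, h2, h1⟩
    refine ⟨max σ (1 / 2), max_lt hσ1 (by norm_num), fun j => ?_⟩
    by_cases hj : ‖ζ j‖ < 1 / 2
    · exact hj.le.trans (le_max_right _ _)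
    · exact (hσ j hj).trans (le_max_left _ _)
  refine ⟨(1 + σ) / 2, by linarith, ?_⟩
  filter_upwards [Metric.ball_mem_nhds ζ (show (0 : ℝ) < (1 - σ) / 2 by linarith)] with ξ h2 j
  have h3 := lp.norm_apply_le_norm (p := 1) (by simp) (ξ - ζ) j
  rw [Metric.mem_ball, dist_eq_norm] at h2
  have h4 : ‖ξ j‖ ≤ ‖(ξ - ζ) j‖ + ‖ζ j‖ := by
    simpa using norm_add_le ((ξ - ζ) j) (ζ j)
  linarith [hσ j]

lemma exists_sum_sq_norm_monomial_le {ζ : EllOne} (hζ : ζ ∈ polydisk) :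
    ∃ C, ∀ᶠ ξ in 𝓝 ζ, ∀ T : Finset ℕ+, ∑ n ∈ T, ‖monomial n fun j => ξ j‖ ^ 2 ≤ C := by
  obtain ⟨ρ, hρ, h⟩ := exists_norm_le_of_mem_polydisk hζ
  refine ⟨Real.exp ((‖ζ‖ + 1) / (1 - ρ)), ?_⟩
  filter_upwards [h, Metric.ball_mem_nhds ζ one_pos] with ξ h1 h2 T
  refine (sum_sq_norm_monomial_le hρ h1 T).trans ?_
  have h3 : 0 < 1 - ρ := by linarith
  gcongr
  rw [Metric.mem_ball, dist_eq_norm] at h2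
  have := norm_add_le (ξ - ζ) ζ
  rw [sub_add_cancel] at this
  linarith

/-! ### Khinchine's inequality by moments of random signs -/

section Khinchine

variable {ι : Type*} [DecidableEq ι]

/-- The signed sum of `b` over `T`, with sign `+` on `S` and `-` off `S`. -/
noncomputable def signedSum (b : ι → ℂ) (T S : Finset ι) : ℂ :=
  ∑ n ∈ T, if n ∈ S then b n else -b n

lemma signedSum_insert_left (b : ι → ℂ) {a : ι} {T S : Finset ι} (ha : a ∉ T) (hS : S ⊆ T) :
    signedSum b (insert a T) S = signedSum b T S - b a := by
  rw [signedSum, Finset.sum_insert ha, if_neg fun h => ha (hS h), signedSum]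
  ring

lemma signedSum_insert_insert (b : ι → ℂ) {a : ι} {T S : Finset ι} (ha : a ∉ T) :
    signedSum b (insert a T) (insert a S) = signedSum b T S + b a := by
  rw [signedSum, Finset.sum_insert ha, if_pos (Finset.mem_insert_self a S), signedSum, add_comm]
  congr 1
  refine Finset.sum_congr rfl fun n hn => ?_
  have : n ≠ a := fun h => ha (h ▸ hn)
  simp [this]

/-- Conditioning on the sign of the new term; this is the induction step for both moments. -/
lemma sum_powerset_signedSum_insert (g : ℂ → ℝ) (b : ι → ℂ) {a : ι} {T : Finset ι} (ha : a ∉ T) :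
    ∑ S ∈ (insert a T).powerset, g (signedSum b (insert a T) S) =
      ∑ S ∈ T.powerset, (g (signedSum b T S - b a) + g (signedSum b T S + b a)) := by
  rw [Finset.sum_powerset_insert ha, Finset.sum_add_distrib]
  congr 1
  · exact Finset.sum_congr rfl fun S hS => by
      rw [signedSum_insert_left b ha (Finset.mem_powerset.1 hS)]
  · exact Finset.sum_congr rfl fun S _ => by rw [signedSum_insert_insert b ha]

lemma sum_sq_norm_signedSum (b : ι → ℂ) (T : Finset ι) :
    ∑ S ∈ T.powerset, ‖signedSum b T S‖ ^ 2 = 2 ^ T.card * ∑ n ∈ T, ‖b n‖ ^ 2 := by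
  induction T using Finset.induction_on with
  | empty => simp [signedSum]
  | insert a T ha ih =>
    rw [sum_powerset_signedSum_insert (fun z => ‖z‖ ^ 2) b ha, Finset.sum_insert ha,
      Finset.card_insert_of_notMem ha]
    have h : ∀ S, ‖signedSum b T S - b a‖ ^ 2 + ‖signedSum b T S + b a‖ ^ 2 =
        2 * ‖signedSum b T S‖ ^ 2 + 2 * ‖b a‖ ^ 2 := fun S => by
      have := parallelogram_law_with_norm ℝ (signedSum b T S) (b a)
      linear_combination this
    simp_rw [h]
    rw [Finset.sum_add_distrib, ← Finset.mul_sum, ih, Finset.sum_const, Finset.card_powerset,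
      nsmul_eq_mul]
    push_cast
    ring

/-- With `s = ‖x‖² + ‖y‖²` and `t = 2⟨x, y⟩` the left side is `(s - t)² + (s + t)² = 2s² + 2t²`, and
Cauchy–Schwarz bounds `t²`. -/
lemma norm_sub_pow_four_add_le (x y : ℂ) :
    ‖x - y‖ ^ 4 + ‖x + y‖ ^ 4 ≤ 2 * ‖x‖ ^ 4 + 12 * (‖x‖ ^ 2 * ‖y‖ ^ 2) + 2 * ‖y‖ ^ 4 := by
  have h1 := norm_sub_sq_real x y
  have h2 := norm_add_sq_real x y
  have h3 := abs_real_inner_le_norm x y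
  have h4 : inner ℝ x y ^ 2 ≤ (‖x‖ * ‖y‖) ^ 2 := sq_le_sq' (abs_le.1 h3).1 (abs_le.1 h3).2
  have e : ∀ z : ℂ, ‖z‖ ^ 4 = (‖z‖ ^ 2) ^ 2 := fun z => by ring
  rw [e (x - y), e (x + y), h1, h2]
  nlinarith

lemma sum_pow_four_norm_signedSum_le (b : ι → ℂ) (T : Finset ι) :
    ∑ S ∈ T.powerset, ‖signedSum b T S‖ ^ 4 ≤ 2 ^ T.card * (3 * (∑ n ∈ T, ‖b n‖ ^ 2) ^ 2) := by
  induction T using Finset.induction_on with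
  | empty => simp [signedSum]
  | insert a T ha ih =>
    rw [sum_powerset_signedSum_insert (fun z => ‖z‖ ^ 4) b ha, Finset.sum_insert ha,
      Finset.card_insert_of_notMem ha]
    refine (Finset.sum_le_sum fun S _ => norm_sub_pow_four_add_le _ _).trans ?_
    rw [Finset.sum_add_distrib, Finset.sum_add_distrib, ← Finset.mul_sum, ← Finset.mul_sum,
      ← Finset.sum_mul, sum_sq_norm_signedSum, Finset.sum_const, Finset.card_powerset,
      nsmul_eq_mul]
    push_cast
    -- The constant `3` matches the `‖b a‖²` cross term exactly (`12 = 2 · 2 · 3`); the slack is `(6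
    -- - 2) ‖b a‖⁴`.
    have : 0 ≤ (2 : ℝ) ^ T.card * ‖b a‖ ^ 4 := by positivity
    linear_combination 2 * ih + 4 * this

/-- The lower Khinchine inequality in `L¹`. -/
lemma khinchine_lower (b : ι → ℂ) (T : Finset ι) :
    2 ^ T.card * (9 / 16 * √(∑ n ∈ T, ‖b n‖ ^ 2)) ≤ ∑ S ∈ T.powerset, ‖signedSum b T S‖ := by
  set σ := √(∑ n ∈ T, ‖b n‖ ^ 2) with hσ
  have hσ0 : 0 ≤ σ := Real.sqrt_nonneg _
  have hσ2 : σ ^ 2 = ∑ n ∈ T, ‖b n‖ ^ 2 := Real.sq_sqrt (by positivity)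
  rcases hσ0.eq_or_lt with h0 | hpos
  · rw [← h0]
    simp only [mul_zero]
    positivity
  -- A minorant of `t` by second and fourth powers, touching at `t = 2σ`. Averaging it with moments
  -- `σ²` and at most `3σ⁴` gives the constant `3/4 - 3/16 = 9/16`.
  have hpt : ∀ t : ℝ, 0 ≤ t → 3 / 4 * σ ^ 2 * t ^ 2 - 1 / 16 * t ^ 4 ≤ σ ^ 3 * t := fun t ht => by
    have : 0 ≤ t * ((t - 2 * σ) ^ 2 * (t / 16 + σ / 4)) := by positivity
    nlinarith
  have h2 := sum_sq_norm_signedSum b T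
  have h4 := sum_pow_four_norm_signedSum_le b T
  have hsum := Finset.sum_le_sum fun S (_ : S ∈ T.powerset) => hpt ‖signedSum b T S‖ (norm_nonneg _)
  rw [Finset.sum_sub_distrib, ← Finset.mul_sum, ← Finset.mul_sum, ← Finset.mul_sum, h2] at hsum
  rw [← hσ2] at h4 hsum
  have h3 : 0 < σ ^ 3 := by positivity
  refine le_of_mul_le_mul_left ?_ h3
  nlinarith

end Khinchine

/-! ### Integration on the torus -/

instance : IsProbabilityMeasure torusMeasure := by
  unfold torusMeasure
  infer_instance

instance : torusMeasure.IsAddLeftInvariant where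
  map_add_left_eq_self t := by
    change Measure.map (fun (x : Torus) i => t i + x i) torusMeasure = _
    rw [torusMeasure, Measure.infinitePi_map_pi
      (μ := fun _ : ℕ => (AddCircle.haarAddCircle : Measure (AddCircle (2 * Real.pi))))
      (f := fun i x => t i + x) (hf := fun i => measurable_const_add _)]
    simp [map_add_left_eq_self]

lemma integrable_of_continuous {E : Type*} [NormedAddCommGroup E] [SecondCountableTopology E]
    {f : Torus → E} (hf : Continuous f) : Integrable f torusMeasure :=
  hf.integrable_of_hasCompactSupport (HasCompactSupport.of_compactSpace f)

lemma continuous_monomial (n : ℕ+) : Continuous fun ζ : EllOne => monomial n fun j => ζ j := by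
  unfold monomial
  refine continuous_finsetProd _ fun j _ => Continuous.pow ?_ _
  exact (continuous_apply j).comp
    (lp.uniformContinuous_coe (E := fun _ : ℕ => ℂ) (p := 1)).continuous

lemma continuous_monomial_dilate (n : ℕ+) (r : Set.Ioo (0 : ℝ) 1) :
    Continuous fun θ => monomial n fun j => dilate r θ j :=
  (continuous_monomial n).comp (continuous_dilate r)

/-- The constant modulus of the monomial `ζ^{α(n)}` on the torus `{(r w_1, r² w_2, …)}`. -/
noncomputable def weight (r : ℝ) (n : ℕ+) : ℝ := ∏ j ∈ Finset.range n, (r ^ (j + 1)) ^ expo n j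

lemma norm_monomial_dilate (n : ℕ+) (r : Set.Ioo (0 : ℝ) 1) (θ : Torus) :
    ‖monomial n fun j => dilate r θ j‖ = weight r n := by
  rw [norm_monomial, weight]
  refine Finset.prod_congr rfl fun j _ => ?_
  simp [dilate, abs_of_pos r.2.1, Circle.norm_coe]

lemma weight_nonneg (r : Set.Ioo (0 : ℝ) 1) (n : ℕ+) : 0 ≤ weight r n :=
  (norm_nonneg _).trans_eq (norm_monomial_dilate n r 0)

lemma weight_le_one (r : Set.Ioo (0 : ℝ) 1) (n : ℕ+) : weight r n ≤ 1 :=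
  Finset.prod_le_one (fun _ _ => pow_nonneg (pow_nonneg r.2.1.le _) _)
    fun _ _ => pow_le_one₀ (pow_nonneg r.2.1.le _) (pow_le_one₀ r.2.1.le r.2.2.le)

lemma continuous_weight (n : ℕ+) : Continuous fun r => weight r n := by
  unfold weight
  fun_prop

lemma weight_one (n : ℕ+) : weight 1 n = 1 := by simp [weight]

lemma monomial_dilate_add_single (n : ℕ+) (r : Set.Ioo (0 : ℝ) 1) (θ : Torus) (j : ℕ)
    (φ : AddCircle (2 * Real.pi)) :
    monomial n (fun i => dilate r (Pi.single j φ + θ) i) =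
      fourier (expo n j : ℤ) φ * monomial n fun i => dilate r θ i := by
  have h : ∀ i, dilate r (Pi.single j φ + θ) i =
      (AddCircle.toCircle ((Pi.single j φ : Torus) i) : ℂ) * dilate r θ i := fun i => by
    simp only [dilate, Pi.add_apply, AddCircle.toCircle_add, Circle.coe_mul]
    ring
  simp only [monomial, h, mul_pow, Finset.prod_mul_distrib]
  congr 1
  rw [Finset.prod_eq_single j]
  · simp [fourier_apply, AddCircle.toCircle_nsmul]
  · intro i _ hij
    simp [hij, AddCircle.toCircle_zero]
  -- The coordinate `j` may lie outside the product's range; its exponent is then zero and the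
  -- character is trivial.
  · intro hj
    rw [expo_eq_zero n (by simpa using hj), pow_zero]

/-- Rotating a coordinate in which the exponents differ multiplies the integrand by a character; at
a suitable angle this factor is `-1`, so translation invariance makes the integral its own negative.
-/
lemma integral_monomial_mul_conj_of_ne {n k : ℕ+} (hnk : n ≠ k) (r : Set.Ioo (0 : ℝ) 1) :
    ∫ θ, (monomial n fun j => dilate r θ j) *
      (starRingEnd ℂ) (monomial k fun j => dilate r θ j) ∂torusMeasure = 0 := by
  obtain ⟨j, hj⟩ : ∃ j, expo n j ≠ expo k j := by
    by_contra! h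
    exact hnk (expo_injective h)
  set d : ℤ := (expo n j : ℤ) + -(expo k j : ℤ) with hd
  have hd0 : d ≠ 0 := by omega
  -- The angle `π / d`, at which the character of index `d` equals `-1`.
  let φ : AddCircle (2 * Real.pi) := ((2 * Real.pi / 2 / d : ℝ) : AddCircle (2 * Real.pi))
  have hφ : fourier (expo n j : ℤ) φ * (starRingEnd ℂ) (fourier (expo k j : ℤ) φ) = -1 := by
    rw [← fourier_neg, ← fourier_add, ← hd]
    have := fourier_add_half_inv_index hd0 Real.two_pi_pos 0
    rwa [zero_add, fourier_eval_zero] at this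
  set I := ∫ θ, (monomial n fun j => dilate r θ j) *
      (starRingEnd ℂ) (monomial k fun j => dilate r θ j) ∂torusMeasure with hI
  have h := integral_add_left_eq_self (μ := torusMeasure)
    (fun θ => (monomial n fun j => dilate r θ j) *
      (starRingEnd ℂ) (monomial k fun j => dilate r θ j)) (Pi.single j φ : Torus)
  simp only [monomial_dilate_add_single, map_mul] at h
  have h2 : ∀ θ : Torus, fourier (expo n j : ℤ) φ * (monomial n fun j => dilate r θ j) *
      ((starRingEnd ℂ) (fourier (expo k j : ℤ) φ) *
        (starRingEnd ℂ) (monomial k fun j => dilate r θ j)) =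
      (-1) * ((monomial n fun j => dilate r θ j) *
        (starRingEnd ℂ) (monomial k fun j => dilate r θ j)) := fun θ => by
    rw [← hφ]; ring
  simp only [h2] at h
  rw [integral_const_mul, ← hI] at h
  have : (2 : ℂ) * I = 0 := by linear_combination -h
  simpa using this

/-- Parseval's identity for Dirichlet polynomials. -/
lemma integral_sq_norm_sum_monomial (a : ℕ+ → ℂ) (T : Finset ℕ+) (r : Set.Ioo (0 : ℝ) 1) :
    ∫ θ, ‖∑ n ∈ T, a n * monomial n fun j => dilate r θ j‖ ^ 2 ∂torusMeasure =
      ∑ n ∈ T, ‖a n‖ ^ 2 * weight r n ^ 2 := by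
  have hint : ∀ n k, Integrable (fun θ => a n * (starRingEnd ℂ) (a k) *
      ((monomial n fun j => dilate r θ j) *
        (starRingEnd ℂ) (monomial k fun j => dilate r θ j))) torusMeasure := fun n k =>
    integrable_of_continuous (continuous_const.mul ((continuous_monomial_dilate n r).mul
      (Complex.continuous_conj.comp (continuous_monomial_dilate k r))))
  rw [← Complex.ofReal_inj, ← integral_complex_ofReal]
  have h : ∀ θ, ((‖∑ n ∈ T, a n * monomial n fun j => dilate r θ j‖ ^ 2 : ℝ) : ℂ) =
      ∑ n ∈ T, ∑ k ∈ T, a n * (starRingEnd ℂ) (a k) * ((monomial n fun j => dilate r θ j) *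
        (starRingEnd ℂ) (monomial k fun j => dilate r θ j)) := fun θ => by
    rw [Complex.ofReal_pow, ← Complex.mul_conj', map_sum, Finset.sum_mul_sum]
    refine Finset.sum_congr rfl fun n _ => Finset.sum_congr rfl fun k _ => ?_
    rw [map_mul]
    ring
  simp_rw [h]
  rw [integral_finsetSum _ fun n _ => integrable_finsetSum _ fun k _ => hint n k]
  push_cast
  refine Finset.sum_congr rfl fun n hn => ?_
  rw [integral_finsetSum _ fun k _ => hint n k, Finset.sum_eq_single n]
  · rw [integral_const_mul]
    simp only [Complex.mul_conj', norm_monomial_dilate]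
    simp
  · intro k _ hkn
    rw [integral_const_mul, integral_monomial_mul_conj_of_ne hkn.symm, mul_zero]
  · exact fun h => absurd hn h

/-! ### Square summable sequences are coefficient sequences -/

lemma memlp_two_iff {a : ℕ+ → ℂ} : Memℓp a 2 ↔ Summable fun n => ‖a n‖ ^ 2 := by
  rw [memℓp_gen_iff (by simp)]
  simp

/-- Weighted AM–GM. The free parameter `δ` lets a small tail of `a` compensate for a merely bounded
sum of `b`. -/
lemma sum_norm_mul_le (a b : ℕ+ → ℂ) {δ : ℝ} (hδ : 0 < δ) (T : Finset ℕ+) :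
    ∑ n ∈ T, ‖a n * b n‖ ≤ (∑ n ∈ T, ‖a n‖ ^ 2) / δ + δ * ∑ n ∈ T, ‖b n‖ ^ 2 := by
  rw [Finset.sum_div, Finset.mul_sum, ← Finset.sum_add_distrib]
  refine Finset.sum_le_sum fun n _ => ?_
  rw [norm_mul]
  have h : 0 ≤ ‖a n‖ * ‖b n‖ := by positivity
  have h2 : 0 ≤ (‖a n‖ - δ * ‖b n‖) ^ 2 / δ := by positivity
  have h3 : (‖a n‖ - δ * ‖b n‖) ^ 2 / δ =
      ‖a n‖ ^ 2 / δ + δ * ‖b n‖ ^ 2 - 2 * (‖a n‖ * ‖b n‖) := by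
    field_simp
    ring
  linarith

lemma summable_mul_monomial {a : ℕ+ → ℂ} (ha : Summable fun n => ‖a n‖ ^ 2) {ζ : EllOne}
    (hζ : ζ ∈ polydisk) : Summable fun n => ‖a n * monomial n fun j => ζ j‖ := by
  obtain ⟨C, hC⟩ := exists_sum_sq_norm_monomial_le hζ
  refine summable_of_sum_le (c := (∑' n, ‖a n‖ ^ 2) / 1 + 1 * C) (fun _ => norm_nonneg _)
    fun T => ?_
  refine (sum_norm_mul_le a _ one_pos T).trans ?_
  gcongr
  · exact ha.sum_le_tsum T fun _ _ => by positivity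
  · exact hC.self_of_nhds T

/-- Partial sums over `T' ⊇ T` differ from that over `T` by terms off `T`. Large `T` gives tail
estimates, and `T = ∅` bounds the whole sum. -/
lemma norm_sub_sum_le_of_hasSum {ι : Type*} [DecidableEq ι] {f : ι → ℂ} {x : ℂ} {c : ℝ}
    (hf : HasSum f x) (T : Finset ι) (h : ∀ t, Disjoint t T → ∑ n ∈ t, ‖f n‖ ≤ c) :
    ‖x - ∑ n ∈ T, f n‖ ≤ c := by
  refine le_of_tendsto (hf.sub_const (∑ n ∈ T, f n)).norm ?_
  filter_upwards [eventually_ge_atTop T] with T' hT'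
  rw [← Finset.sum_sdiff hT', add_sub_cancel_right]
  exact (norm_sum_le _ _).trans (h _ Finset.sdiff_disjoint)

/-- The sum of the monomial series with coefficients `a`. -/
noncomputable def monomialSeries (a : ℕ+ → ℂ) (ζ : EllOne) : ℂ :=
  ∑' n, a n * monomial n fun j => ζ j

variable {a : ℕ+ → ℂ}

lemma hasMonomialExpansion_monomialSeries (ha : Summable fun n => ‖a n‖ ^ 2) :
    HasMonomialExpansion (monomialSeries a) a := fun _ hζ =>
  (summable_mul_monomial ha hζ).of_norm.hasSum

lemma tendstoLocallyUniformlyOn_monomialSeries (ha : Summable fun n => ‖a n‖ ^ 2) :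
    TendstoLocallyUniformlyOn (fun (T : Finset ℕ+) ζ => ∑ n ∈ T, a n * monomial n fun j => ζ j)
      (monomialSeries a) atTop polydisk := by
  rw [Metric.tendstoLocallyUniformlyOn_iff]
  intro ε hε ζ hζ
  obtain ⟨C, hC⟩ := exists_sum_sq_norm_monomial_le hζ
  have hC0 : 0 ≤ C := by simpa using hC.self_of_nhds ∅
  -- First `δ` makes the monomial part at most `ε/4` throughout the neighbourhood, then the tail of
  -- `∑ |a_n|²` is taken below `δ ε/4`; `C + 1` avoids dividing by zero.
  have hδ : 0 < ε / 4 / (C + 1) := by positivity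
  set δ := ε / 4 / (C + 1) with hδd
  have hδC : δ * C ≤ ε / 4 := by
    rw [hδd, div_mul_eq_mul_div, div_le_iff₀ (by positivity)]
    nlinarith
  obtain ⟨s, hs⟩ := summable_iff_vanishing_norm.1 ha (ε / 4 * δ) (by positivity)
  refine ⟨_, inter_mem (mem_nhdsWithin_of_mem_nhds hC) self_mem_nhdsWithin, ?_⟩
  filter_upwards [eventually_ge_atTop s] with T hT ξ hξ
  rw [dist_eq_norm]
  refine (norm_sub_sum_le_of_hasSum (hasMonomialExpansion_monomialSeries ha ξ hξ.2) T
    (c := ε / 2) fun t ht => ?_).trans_lt (by linarith)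
  refine (sum_norm_mul_le a _ hδ t).trans ?_
  have h1 : (∑ n ∈ t, ‖a n‖ ^ 2) / δ ≤ ε / 4 := by
    rw [div_le_iff₀ hδ]
    exact (le_abs_self _).trans (hs t (ht.mono_right hT)).le
  have h2 : δ * ∑ n ∈ t, ‖monomial n fun j => ξ j‖ ^ 2 ≤ ε / 4 := by
    refine le_trans ?_ hδC
    gcongr
    exact hξ.1 t
  linarith

lemma isAnalytic_monomialSeries (ha : Summable fun n => ‖a n‖ ^ 2) :
    IsAnalytic (monomialSeries a) where
  locallyBounded ζ hζ := by
    obtain ⟨C, hC⟩ := exists_sum_sq_norm_monomial_le hζ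
    refine ⟨(∑' n, ‖a n‖ ^ 2) / 1 + 1 * C, ?_⟩
    filter_upwards [mem_nhdsWithin_of_mem_nhds hC, self_mem_nhdsWithin] with ξ hξ hξ'
    have := norm_sub_sum_le_of_hasSum (hasMonomialExpansion_monomialSeries ha ξ hξ') ∅
      (c := (∑' n, ‖a n‖ ^ 2) / 1 + 1 * C) fun t _ => by
        refine (sum_norm_mul_le a _ one_pos t).trans ?_
        gcongr
        · exact ha.sum_le_tsum t fun _ _ => by positivity
        · exact hξ t
    simpa using this
  analyticOnLines ζ hζ η := by
    have hcont : Continuous fun z : ℂ => ζ + z • η := by fun_prop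
    refine DifferentiableOn.analyticOnNhd ?_ (isOpen_polydisk.preimage hcont)
    -- Along a complex line the partial sums are polynomials in `z`, and locally uniform limits of
    -- holomorphic functions are holomorphic.
    refine ((tendstoLocallyUniformlyOn_monomialSeries ha).comp (fun z : ℂ => ζ + z • η)
      (fun z hz => hz) hcont.continuousOn).differentiableOn (Eventually.of_forall fun T => ?_)
      (isOpen_polydisk.preimage hcont)
    refine Differentiable.differentiableOn ?_
    change Differentiable ℂ fun z : ℂ => ∑ n ∈ T, a n * monomial n fun j => ζ j + z * η j
    unfold monomial
    fun_prop

/-- Absolute convergence at the single point `θ = 0` suffices, since the moduli of the monomials do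
not depend on `θ`. -/
lemma summable_mul_weight {F : EllOne → ℂ} (hF : HasMonomialExpansion F a)
    (r : Set.Ioo (0 : ℝ) 1) : Summable fun n => ‖a n‖ * weight r n := by
  have := (hF _ (dilate_mem_polydisk r 0)).summable.norm
  simpa only [norm_mul, norm_monomial_dilate] using this

lemma norm_sum_mul_monomial_dilate_le (r : Set.Ioo (0 : ℝ) 1)
    (ha : Summable fun n => ‖a n‖ * weight r n) (T : Finset ℕ+) (θ : Torus) :
    ‖∑ n ∈ T, a n * monomial n fun j => dilate r θ j‖ ≤ ∑' n, ‖a n‖ * weight r n := by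
  refine (norm_sum_le _ _).trans ?_
  simp only [norm_mul, norm_monomial_dilate]
  exact ha.sum_le_tsum T fun n _ => mul_nonneg (norm_nonneg _) (weight_nonneg r n)

/-- Parseval for partial sums with weights at most `1`, passed to the limit by dominated
convergence; for fixed `r` the dominating function is constant. -/
lemma integral_sq_norm_monomialSeries_le (ha : Summable fun n => ‖a n‖ ^ 2)
    (r : Set.Ioo (0 : ℝ) 1) :
    ∫ θ, ‖monomialSeries a (dilate r θ)‖ ^ 2 ∂torusMeasure ≤ ∑' n, ‖a n‖ ^ 2 := by
  have hE := hasMonomialExpansion_monomialSeries ha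
  have hw := summable_mul_weight hE r
  have hlim := tendsto_integral_filter_of_dominated_convergence
    (μ := torusMeasure) (l := (atTop : Filter (Finset ℕ+)))
    (F := fun T θ => ‖∑ n ∈ T, a n * monomial n fun j => dilate r θ j‖ ^ 2)
    (f := fun θ => ‖monomialSeries a (dilate r θ)‖ ^ 2)
    (fun _ => (∑' n, ‖a n‖ * weight r n) ^ 2)
    (Eventually.of_forall fun T => (integrable_of_continuous
      ((continuous_finsetSum _ fun n _ => continuous_const.mul
        (continuous_monomial_dilate n r)).norm.pow 2)).aestronglyMeasurable)
    (Eventually.of_forall fun T => Eventually.of_forall fun θ => by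
      rw [norm_pow, norm_norm]
      gcongr
      exact norm_sum_mul_monomial_dilate_le r hw T θ)
    (integrable_const _)
    (Eventually.of_forall fun θ => (hE _ (dilate_mem_polydisk r θ)).norm.pow 2)
  refine le_of_tendsto' hlim fun T => ?_
  rw [integral_sq_norm_sum_monomial]
  refine le_trans (Finset.sum_le_sum fun n _ => ?_) (ha.sum_le_tsum T fun _ _ => by positivity)
  exact mul_le_of_le_one_right (by positivity)
    (pow_le_one₀ (weight_nonneg r n) (weight_le_one r n))

/-- Replaces Hölder's inequality: on a probability space this already makes the `p`-th means finite
once the `L²` means are bounded. -/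
lemma enorm_rpow_le {p : ℝ} (hp1 : 1 ≤ p) (hp2 : p ≤ 2) (z : ℂ) :
    ‖z‖ₑ ^ p ≤ ENNReal.ofReal (1 + ‖z‖ ^ 2) := by
  rw [← ofReal_norm, ENNReal.ofReal_rpow_of_nonneg (norm_nonneg _) (by linarith)]
  refine ENNReal.ofReal_le_ofReal ?_
  rcases le_total ‖z‖ 1 with h | h
  · have := Real.rpow_le_one (norm_nonneg z) h (by linarith : 0 ≤ p)
    nlinarith [sq_nonneg ‖z‖]
  · have := Real.rpow_le_rpow_of_exponent_le h hp2
    rw [Real.rpow_two] at this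
    linarith

lemma memHardy_monomialSeries {p : ℝ} (hp1 : 1 ≤ p) (hp2 : p ≤ 2)
    (ha : Summable fun n => ‖a n‖ ^ 2) : MemHardy p (monomialSeries a) := by
  have hA := isAnalytic_monomialSeries ha
  refine ⟨hA, (iSup_le fun r => ?_).trans_lt
    (ENNReal.ofReal_lt_top (r := 1 + ∑' n, ‖a n‖ ^ 2))⟩
  have hint : Integrable (fun θ => ‖monomialSeries a (dilate r θ)‖ ^ 2) torusMeasure :=
    integrable_of_continuous ((hA.continuous_dilate r).norm.pow 2)
  refine (lintegral_mono fun θ => enorm_rpow_le hp1 hp2 _).trans ?_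
  rw [← ofReal_integral_eq_lintegral_ofReal
    (f := fun θ => 1 + ‖monomialSeries a (dilate r θ)‖ ^ 2) ((integrable_const 1).add hint)
    (Eventually.of_forall fun θ => by simp only [Pi.zero_apply]; positivity)]
  refine ENNReal.ofReal_le_ofReal ?_
  rw [integral_add (integrable_const 1) hint]
  simpa using integral_sq_norm_monomialSeries_le ha r

lemma mem_hardySpace_of_summable {p : ℝ} (hp1 : 1 ≤ p) (hp2 : p ≤ 2)
    (ha : Summable fun n => ‖a n‖ ^ 2) : a ∈ hardySpace p hp1 :=
  ⟨_, memHardy_monomialSeries hp1 hp2 ha, hasMonomialExpansion_monomialSeries ha⟩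

/-! ### The solid core consists of square summable sequences -/

/-- The sequence `a` with the entries outside `{n | x n}` replaced by `0`. -/
def mask (a : ℕ+ → ℂ) (x : ℕ+ → Bool) (n : ℕ+) : ℂ := if x n then a n else 0

variable {a : ℕ+ → ℂ} {p : ℝ} {hp1 : 1 ≤ p}

lemma norm_mask_le (a : ℕ+ → ℂ) (x : ℕ+ → Bool) (n : ℕ+) : ‖mask a x n‖ ≤ ‖a n‖ := by
  unfold mask
  split_ifs <;> simp

lemma mask_mem_hardySpace (ha : a ∈ solidCore (hardySpace p hp1)) (x : ℕ+ → Bool) :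
    mask a x ∈ hardySpace p hp1 :=
  (isGreatest_solidCore _).1.2 ((isGreatest_solidCore _).1.1 a ha _ (norm_mask_le a x))

lemma monomialSeries_eq {F : EllOne → ℂ} (hF : HasMonomialExpansion F a) {ζ : EllOne}
    (hζ : ζ ∈ polydisk) : monomialSeries a ζ = F ζ := (hF ζ hζ).tsum_eq

/-- Since `t ≤ 1 + t^p`, the problem reduces to `L¹` means. The bound is a natural number so that
Baire's theorem sees a countable cover. -/
lemma exists_integral_norm_le (ha : a ∈ hardySpace p hp1) :
    ∃ N : ℕ, ∀ r : Set.Ioo (0 : ℝ) 1,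
      ∫ θ, ‖monomialSeries a (dilate r θ)‖ ∂torusMeasure ≤ N := by
  obtain ⟨F, ⟨hA, hfin⟩, hF⟩ := ha
  obtain ⟨N, hN⟩ := exists_nat_ge (1 + hardyNormPow p F).toReal
  refine ⟨N, fun r => le_trans ?_ hN⟩
  simp only [monomialSeries_eq hF (dilate_mem_polydisk r _)]
  rw [integral_norm_eq_lintegral_enorm (hA.continuous_dilate r).aestronglyMeasurable]
  refine ENNReal.toReal_mono (ENNReal.add_ne_top.2 ⟨ENNReal.one_ne_top, hfin.ne⟩) ?_
  calc ∫⁻ θ, ‖F (dilate r θ)‖ₑ ∂torusMeasure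
      ≤ ∫⁻ θ, (1 + ‖F (dilate r θ)‖ₑ ^ p) ∂torusMeasure := by
        refine lintegral_mono fun θ => ?_
        rcases le_total ‖F (dilate r θ)‖ₑ 1 with h | h
        · exact h.trans le_self_add
        · refine le_trans ?_ le_add_self
          simpa using ENNReal.rpow_le_rpow_of_exponent_le h hp1
    _ = 1 + ∫⁻ θ, ‖F (dilate r θ)‖ₑ ^ p ∂torusMeasure := by
        rw [lintegral_add_left measurable_const]
        simp
    _ ≤ 1 + hardyNormPow p F := by
        gcongr
        exact le_iSup (fun r : Set.Ioo (0 : ℝ) 1 =>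
          ∫⁻ θ, ‖F (dilate r θ)‖ₑ ^ p ∂torusMeasure) r

lemma continuous_mask (a : ℕ+ → ℂ) (n : ℕ+) : Continuous fun x => mask a x n :=
  (continuous_of_discreteTopology (f := fun b : Bool => if b then a n else 0)).comp
    (continuous_apply n)

lemma norm_mask_mul_monomial_dilate_le (a : ℕ+ → ℂ) (r : Set.Ioo (0 : ℝ) 1) (x : ℕ+ → Bool)
    (θ : Torus) (n : ℕ+) :
    ‖mask a x n * monomial n fun j => dilate r θ j‖ ≤ ‖a n‖ * weight r n := by
  rw [norm_mul, norm_monomial_dilate]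
  exact mul_le_mul_of_nonneg_right (norm_mask_le a x n) (weight_nonneg r n)

lemma continuous_monomialSeries_mask_dilate (r : Set.Ioo (0 : ℝ) 1)
    (ha : Summable fun n => ‖a n‖ * weight r n) (x : ℕ+ → Bool) :
    Continuous fun θ => monomialSeries (mask a x) (dilate r θ) :=
  continuous_tsum (fun n => continuous_const.mul (continuous_monomial_dilate n r)) ha
    fun n θ => norm_mask_mul_monomial_dilate_le a r x θ n

/-- Continuity in the mask, for fixed `r`, is what makes the sets in the Baire argument closed. -/
lemma continuous_integral_norm_monomialSeries_mask (r : Set.Ioo (0 : ℝ) 1)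
    (ha : Summable fun n => ‖a n‖ * weight r n) :
    Continuous fun x => ∫ θ, ‖monomialSeries (mask a x) (dilate r θ)‖ ∂torusMeasure := by
  refine continuous_of_dominated (bound := fun _ => ∑' n, ‖a n‖ * weight r n)
    (fun x => (continuous_monomialSeries_mask_dilate r ha x).norm.aestronglyMeasurable)
    (fun x => Eventually.of_forall fun θ => ?_) (integrable_const _)
    (Eventually.of_forall fun θ => Continuous.norm ?_)
  · rw [norm_norm]
    exact tsum_of_norm_bounded ha.hasSum fun n => norm_mask_mul_monomial_dilate_le a r x θ n
  · exact continuous_tsum (fun n => (continuous_mask a n).mul continuous_const) ha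
      fun n x => norm_mask_mul_monomial_dilate_le a r x θ n

/-- By Baire's theorem the `L¹` means are uniformly bounded over a cylinder of masks. -/
lemma exists_cylinder_integral_norm_le (ha : a ∈ solidCore (hardySpace p hp1)) :
    ∃ (N : ℕ) (I : Finset ℕ+) (x₀ : ℕ+ → Bool), ∀ x : ℕ+ → Bool, (∀ n ∈ I, x n = x₀ n) →
      ∀ r : Set.Ioo (0 : ℝ) 1,
        ∫ θ, ‖monomialSeries (mask a x) (dilate r θ)‖ ∂torusMeasure ≤ N := by
  obtain ⟨F, -, hF⟩ := (isGreatest_solidCore _).1.2 ha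
  let E : ℕ → Set (ℕ+ → Bool) := fun N => {x | ∀ r : Set.Ioo (0 : ℝ) 1,
    ∫ θ, ‖monomialSeries (mask a x) (dilate r θ)‖ ∂torusMeasure ≤ N}
  have hclosed : ∀ N, IsClosed (E N) := fun N => by
    simp only [E, Set.ofPred_forall]
    exact isClosed_iInter fun r => isClosed_le
      (continuous_integral_norm_monomialSeries_mask r (summable_mul_weight hF r)) continuous_const
  have hunion : ⋃ N, E N = Set.univ := Set.eq_univ_of_forall fun x =>
    Set.mem_iUnion.2 (exists_integral_norm_le (mask_mem_hardySpace ha x))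
  -- The space of masks is a product of finite discrete spaces, hence compact Hausdorff and Baire.
  obtain ⟨N, x₀, hx₀⟩ := nonempty_interior_of_iUnion_of_closed hclosed hunion
  obtain ⟨I, u, hu, hsub⟩ := isOpen_pi_iff.1 isOpen_interior x₀ hx₀
  refine ⟨N, I, x₀, fun x hx => interior_subset (hsub fun n hn => ?_)⟩
  rw [hx n hn]
  exact (hu n hn).2

/-- Masks that agree off `T` and are complementary on `T` cancel outside `T` and leave signs `±1`
inside. -/
lemma monomialSeries_mask_sub_mask (r : Set.Ioo (0 : ℝ) 1)
    (ha : Summable fun n => ‖a n‖ * weight r n) {x y : ℕ+ → Bool} {T S : Finset ℕ+}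
    (hxy : ∀ n ∉ T, x n = y n) (hx : ∀ n ∈ T, x n = decide (n ∈ S))
    (hy : ∀ n ∈ T, y n = decide (n ∉ S)) (θ : Torus) :
    monomialSeries (mask a x) (dilate r θ) - monomialSeries (mask a y) (dilate r θ) =
      signedSum (fun n => a n * monomial n fun j => dilate r θ j) T S := by
  have hs : ∀ x, Summable fun n => mask a x n * monomial n fun j => dilate r θ j := fun x =>
    Summable.of_norm_bounded ha fun n => norm_mask_mul_monomial_dilate_le a r x θ n
  rw [monomialSeries, monomialSeries, ← (hs x).tsum_sub (hs y), signedSum, tsum_eq_sum (s := T)]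
  · refine Finset.sum_congr rfl fun n hn => ?_
    by_cases h : n ∈ S <;> simp [mask, hx n hn, hy n hn, h]
  · intro n hn
    simp [mask, hxy n hn]

lemma sum_sq_mul_weight_le {N : ℕ} {I : Finset ℕ+} {x₀ : ℕ+ → Bool} (r : Set.Ioo (0 : ℝ) 1)
    (ha : Summable fun n => ‖a n‖ * weight r n)
    (hN : ∀ x : ℕ+ → Bool, (∀ n ∈ I, x n = x₀ n) →
      ∫ θ, ‖monomialSeries (mask a x) (dilate r θ)‖ ∂torusMeasure ≤ N)
    {T : Finset ℕ+} (hT : Disjoint T I) :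
    ∑ n ∈ T, (‖a n‖ * weight r n) ^ 2 ≤ (32 / 9 * N) ^ 2 := by
  have hcont : ∀ S, Continuous fun θ =>
      ‖signedSum (fun n => a n * monomial n fun j => dilate r θ j) T S‖ := fun S => by
    refine (continuous_finsetSum _ fun n _ => ?_).norm
    have := continuous_monomial_dilate n r
    split_ifs <;> fun_prop
  have hS : ∀ S, ∫ θ, ‖signedSum (fun n => a n * monomial n fun j => dilate r θ j) T S‖
      ∂torusMeasure ≤ 2 * N := fun S => by
    -- Both masks follow `x₀` off `T`, hence on `I`, so both lie in the cylinder.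
    let x : ℕ+ → Bool := fun n => if n ∈ T then decide (n ∈ S) else x₀ n
    let y : ℕ+ → Bool := fun n => if n ∈ T then decide (n ∉ S) else x₀ n
    have hI : ∀ n ∈ I, n ∉ T := fun n hn hn' => Finset.disjoint_left.1 hT hn' hn
    have hx := hN x fun n hn => by simp [x, hI n hn]
    have hy := hN y fun n hn => by simp [y, hI n hn]
    have hix := integrable_of_continuous (continuous_monomialSeries_mask_dilate r ha x).norm
    have hiy := integrable_of_continuous (continuous_monomialSeries_mask_dilate r ha y).norm
    calc _ ≤ ∫ θ, (‖monomialSeries (mask a x) (dilate r θ)‖ +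
          ‖monomialSeries (mask a y) (dilate r θ)‖) ∂torusMeasure := by
          refine integral_mono (integrable_of_continuous (hcont S)) (hix.add hiy) fun θ => ?_
          dsimp only
          rw [← monomialSeries_mask_sub_mask r ha (x := x) (y := y)
            (fun n hn => by simp [x, y, hn]) (fun n hn => by simp [x, hn])
            (fun n hn => by simp [y, hn])]
          exact norm_sub_le _ _
      _ ≤ 2 * N := by
          rw [integral_add hix hiy]
          linarith
  have hpow : (0 : ℝ) < 2 ^ T.card := by positivity
  have key : 2 ^ T.card * (9 / 16 * √(∑ n ∈ T, (‖a n‖ * weight r n) ^ 2)) ≤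
      2 ^ T.card * (2 * N) := by
    calc _ = ∫ _, 2 ^ T.card * (9 / 16 * √(∑ n ∈ T, (‖a n‖ * weight r n) ^ 2))
          ∂torusMeasure := by simp
      _ ≤ ∫ θ, ∑ S ∈ T.powerset,
            ‖signedSum (fun n => a n * monomial n fun j => dilate r θ j) T S‖ ∂torusMeasure := by
          refine integral_mono (integrable_const _)
            (integrable_finsetSum _ fun S _ => integrable_of_continuous (hcont S)) fun θ => ?_
          have := khinchine_lower (fun n => a n * monomial n fun j => dilate r θ j) T
          simpa only [norm_mul, norm_monomial_dilate] using this
      _ = ∑ S ∈ T.powerset, ∫ θ,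
            ‖signedSum (fun n => a n * monomial n fun j => dilate r θ j) T S‖ ∂torusMeasure :=
          integral_finsetSum _ fun S _ => integrable_of_continuous (hcont S)
      _ ≤ ∑ S ∈ T.powerset, (2 * N : ℝ) := Finset.sum_le_sum fun S _ => hS S
      _ = _ := by simp [Finset.card_powerset]
  -- Now `9/16` times the square root is at most `2N`, whence `32/9`.
  have := le_of_mul_le_mul_left key hpow
  refine (Real.sqrt_le_left (by positivity)).1 ?_
  linarith

/-- The bound off `I` is independent of `r` and `T`, and the weights tend to `1` as `r → 1`; the
finitely many indices in `I` only add a constant. -/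
lemma summable_sq_norm_of_mem_solidCore (ha : a ∈ solidCore (hardySpace p hp1)) :
    Summable fun n => ‖a n‖ ^ 2 := by
  obtain ⟨F, -, hF⟩ := (isGreatest_solidCore _).1.2 ha
  obtain ⟨N, I, x₀, hN⟩ := exists_cylinder_integral_norm_le ha
  have hdisj : ∀ T : Finset ℕ+, Disjoint T I → ∑ n ∈ T, ‖a n‖ ^ 2 ≤ (32 / 9 * N : ℝ) ^ 2 := by
    intro T hT
    have hlim : Tendsto (fun r => ∑ n ∈ T, (‖a n‖ * weight r n) ^ 2) (𝓝[<] 1)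
        (𝓝 (∑ n ∈ T, ‖a n‖ ^ 2)) := by
      have hc : Continuous fun r => ∑ n ∈ T, (‖a n‖ * weight r n) ^ 2 :=
        continuous_finsetSum _ fun n _ => (continuous_const.mul (continuous_weight n)).pow 2
      simpa [weight_one] using (hc.tendsto 1).mono_left nhdsWithin_le_nhds
    refine le_of_tendsto hlim ?_
    filter_upwards [Ioo_mem_nhdsLT (zero_lt_one' ℝ)] with r hr
    exact sum_sq_mul_weight_le ⟨r, hr⟩ (summable_mul_weight hF ⟨r, hr⟩)
      (fun x hx => hN x hx ⟨r, hr⟩) hT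
  refine summable_of_sum_le (c := (32 / 9 * N : ℝ) ^ 2 + ∑ n ∈ I, ‖a n‖ ^ 2)
    (fun _ => by positivity) fun T => ?_
  rw [← Finset.sum_inter_add_sum_sdiff T I, add_comm]
  gcongr
  · exact hdisj _ Finset.sdiff_disjoint
  · exact Finset.inter_subset_right

lemma exists_isSolid_square_summable :
    ∃ Y : Submodule ℂ (ℕ+ → ℂ), IsSolid Y ∧ ∀ a, a ∈ Y ↔ Summable fun n => ‖a n‖ ^ 2 := by
  refine ⟨{ carrier := {a | Memℓp a 2}
            zero_mem' := zero_memℓp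
            add_mem' := Memℓp.add
            smul_mem' := fun c _ h => h.const_smul c }, fun a ha b hb => ?_, fun a => memlp_two_iff⟩
  exact memlp_two_iff.2 (Summable.of_nonneg_of_le (fun _ => by positivity)
    (fun n => pow_le_pow_left₀ (norm_nonneg _) (hb n) 2) (memlp_two_iff.1 ha))

end HardyInfinite

theorem proposition3p8 (p : ℝ) (hp1 : 1 ≤ p) (hp2 : p ≤ 2) :
    (HardyInfinite.solidCore (HardyInfinite.hardySpace p hp1) : Set (ℕ+ → ℂ)) =
      {a : ℕ+ → ℂ | Memℓp a 2} := by
  ext a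
  rw [SetLike.mem_coe, Set.mem_ofPred_eq, HardyInfinite.memlp_two_iff]
  refine ⟨HardyInfinite.summable_sq_norm_of_mem_solidCore, fun ha => ?_⟩
  obtain ⟨Y, hY, hmem⟩ := HardyInfinite.exists_isSolid_square_summable
  exact (HardyInfinite.isGreatest_solidCore _).2
    (show Y ∈ _ from ⟨hY, fun b hb =>
      HardyInfinite.mem_hardySpace_of_summable hp1 hp2 ((hmem b).1 hb)⟩) ((hmem a).2 ha)
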